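/- A tournament is a digraph without loops in which, for any two distinct vertices $u,v$, exactly one of the arcs $uv$, $vu$ is present. All paths are directed, and the length of a path is its number of arcs. A digraph $D$ is called path extendable if for every path $P$ in $D$ of length at least $1$ with $V(P)\neq V(D)$ there exist a vertex $w\in V(D)\setminus V(P)$ and a path $P'$ in $D$ with the same initial vertex and the same terminal vertex as $P$ and with $V(P')=V(P)\cup\{w\}$. Theorem 2.8. Almost all tournaments are path extendable. That is, $$\lim_{n\to\infty}\frac{\#\{T : T \text{ is a path extendable tournament on the vertex set } \{0,\dots,n-1\}\}}{\#\{T : T \text{ is a tournament on the vertex set } \{0,\dots,n-1\}\}}=1 .$$ -/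

import Mathlib

open Filter Topology

namespace Digraph

variable {V : Type*}

/-- A tournament: no loops, and between any two distinct vertices exactly one of the two
possible arcs is present. -/
def IsTournament (D : Digraph V) : Prop :=
  (∀ v, ¬ D.Adj v v) ∧ ∀ u v, u ≠ v → Xor (D.Adj u v) (D.Adj v u)

/-- A directed path, given by its nonempty list of vertices in order: the vertices are
pairwise distinct and there is an arc from each vertex to the next one.
The length of the path (its number of arcs) is `p.length - 1`. -/
def IsDiPath (D : Digraph V) (p : List V) : Prop :=
  p ≠ [] ∧ p.Nodup ∧ p.IsChain D.Adj

/-- A path is hamiltonian if it contains all the vertices. -/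
def IsHamiltonianDiPath (D : Digraph V) (p : List V) : Prop :=
  D.IsDiPath p ∧ ∀ v, v ∈ p

/-- The path `p` is extendable in `D`: there is a path `q` in `D` with the same initial vertex
and the same terminal vertex as `p`, whose vertex set is that of `p` together with one further
vertex `w`. -/
def IsExtendable (D : Digraph V) (p : List V) : Prop :=
  ∃ q : List V, D.IsDiPath q ∧ q.head? = p.head? ∧ q.getLast? = p.getLast? ∧
    ∃ w, w ∉ p ∧ {v | v ∈ q} = insert w {v | v ∈ p}

/-- `D` is `{k+}`-path extendable: every nonhamiltonian path of length at least `k`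
(that is, with at least `k + 1` vertices) is extendable in `D`. -/
def IsPathExtendableFrom (D : Digraph V) (k : ℕ) : Prop :=
  ∀ p : List V, D.IsDiPath p → k + 1 ≤ p.length → ¬ D.IsHamiltonianDiPath p → D.IsExtendable p

/-- `D` is path extendable if it is `{1+}`-path extendable. -/
def IsPathExtendable (D : Digraph V) : Prop :=
  D.IsPathExtendableFrom 1

end Digraph

/-- The set of all labelled tournaments with vertex set `{0, …, n - 1}`. -/
def labelledTournaments (n : ℕ) : Set (Digraph (Fin n)) :=
  {T | T.IsTournament}

/-- The proportion of the labelled tournaments on `n` vertices that are path extendable, i.e. the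
probability that a uniformly random labelled tournament on `n` vertices is path extendable. -/
noncomputable def pathExtendableProportion (n : ℕ) : ℝ :=
  ({T ∈ labelledTournaments n | T.IsPathExtendable}.ncard : ℝ) / (labelledTournaments n).ncard

/-! ### Path surgery: inserting a missed vertex -/

namespace Digraph

variable {V : Type*}

/-! Two pseudo-random properties force extendability (`IsTournament.isPathExtendable`): disjoint
sets of size `b` are joined in both directions, and all ordered pairs have at least `20 * b`
two-paths. If `p` is not extendable, each missed vertex `w` dominates an initial segment of `p` and
is dominated by the rest. A threshold far from both ends permits interchanging two segments around
`w` (`LargeSetsJoined.exists_crossing`), so thresholds lie near the ends. Then `p` misses fewer than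
`2 * b` vertices, and a missed vertex has too small an in- or out-degree for the two-path condition.

Both properties hold almost surely for `b` about `n / 200`, by union bounds resting on
`tournamentProb_forall_adj_le`: the errors are `4 ^ n * 2 ^ (-b ^ 2)` and, via an exponential Markov
bound, about `n ^ 2 * 2 ^ a * (7 / 8) ^ n` with `a = 20 * b`. -/

lemma IsTournament.not_adj_iff {D : Digraph V} (hD : D.IsTournament) {u v : V} (h : u ≠ v) :
    ¬ D.Adj u v ↔ D.Adj v u := by
  rcases hD.2 u v h with ⟨h1, h2⟩ | ⟨h1, h2⟩ <;> tauto

lemma IsTournament.not_adj_of_adj {D : Digraph V} (hD : D.IsTournament) {u v : V}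
    (h : D.Adj u v) : ¬ D.Adj v u := by
  have hne : u ≠ v := by
    rintro rfl
    exact hD.1 _ h
  rcases hD.2 u v hne with ⟨h1, h2⟩ | ⟨h1, h2⟩ <;> tauto

/-- Inserting a vertex between two consecutive vertices of a path. -/
lemma IsDiPath.isExtendable_of_insert {D : Digraph V} {X U : List V} {w : V}
    (hp : D.IsDiPath (X ++ U)) (hw : w ∉ X ++ U) (hX : X ≠ []) (hU : U ≠ [])
    (h1 : ∀ x ∈ X.getLast?, D.Adj x w) (h2 : ∀ u ∈ U.head?, D.Adj w u) :
    D.IsExtendable (X ++ U) := by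
  obtain ⟨-, hnd, hch⟩ := hp
  refine ⟨X ++ w :: U, ⟨by simp, ?_, ?_⟩, ?_, ?_, w, hw, ?_⟩
  · have : (X ++ w :: U).Perm (w :: (X ++ U)) := List.perm_middle
    rw [this.nodup_iff]
    exact List.nodup_cons.2 ⟨hw, hnd⟩
  · rw [List.isChain_append] at hch ⊢
    refine ⟨hch.1, ?_, ?_⟩
    · rw [List.isChain_cons]
      exact ⟨h2, hch.2.1⟩
    · simpa using h1
  · simp [List.head?_append, List.head?_eq_some_head hX]
  · obtain ⟨u, U, rfl⟩ := List.exists_cons_of_ne_nil hU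
    simp [List.getLast?_append]
  · ext v
    simp
    tauto

/-- Extending a path by a vertex `w`, with two consecutive inner segments interchanged. -/
lemma IsDiPath.isExtendable_of_swap {D : Digraph V} {X Y Z U : List V} {w : V}
    (hp : D.IsDiPath (X ++ (Y ++ (Z ++ U)))) (hw : w ∉ X ++ (Y ++ (Z ++ U)))
    (hX : X ≠ []) (hY : Y ≠ []) (hZ : Z ≠ []) (hU : U ≠ [])
    (hXZ : ∀ x ∈ X.getLast?, ∀ z ∈ Z.head?, D.Adj x z)
    (hZw : ∀ z ∈ Z.getLast?, D.Adj z w)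
    (hwY : ∀ y ∈ Y.head?, D.Adj w y)
    (hYU : ∀ y ∈ Y.getLast?, ∀ u ∈ U.head?, D.Adj y u) :
    D.IsExtendable (X ++ (Y ++ (Z ++ U))) := by
  obtain ⟨-, hnd, hch⟩ := hp
  have hperm : (X ++ (Z ++ w :: (Y ++ U))).Perm (w :: (X ++ (Y ++ (Z ++ U)))) := by
    classical
    rw [List.perm_iff_count]
    intro c
    simp only [List.count_append, List.count_cons]
    omega
  refine ⟨X ++ (Z ++ w :: (Y ++ U)), ⟨by simp, ?_, ?_⟩, ?_, ?_, w, hw, ?_⟩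
  · rw [hperm.nodup_iff]
    exact List.nodup_cons.2 ⟨hw, hnd⟩
  · simp only [List.isChain_append, List.isChain_cons] at hch ⊢
    refine ⟨hch.1, ⟨hch.2.1.2.1.1, ⟨?_, ⟨hch.2.1.1, hch.2.1.2.1.2.1, hYU⟩⟩, ?_⟩, ?_⟩
    · rw [List.head?_append_of_ne_nil _ hY]
      exact hwY
    · simpa using hZw
    · rw [List.head?_append_of_ne_nil _ hZ]
      exact hXZ
  · rw [List.head?_append_of_ne_nil _ hX, List.head?_append_of_ne_nil _ hX]
  · have h : ∀ A B C : List V, (A ++ (B ++ (C ++ U))).getLast? = U.getLast? := by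
      intro A B C
      rw [← List.append_assoc, ← List.append_assoc, List.getLast?_append_of_ne_nil _ hU]
    rw [h X Y Z, ← h X Z (w :: Y), List.cons_append]
  · ext v
    simpa using hperm.mem_iff (a := v)

lemma IsDiPath.isExtendable_of_adj_adj {D : Digraph V} {p : List V} (hp : D.IsDiPath p) {w : V}
    (hw : w ∉ p) {i : ℕ} (hi : i + 1 < p.length) (h1 : D.Adj p[i] w) (h2 : D.Adj w p[i + 1]) :
    D.IsExtendable p := by
  have hpe : p.take (i + 1) ++ p.drop (i + 1) = p := List.take_append_drop _ _
  have := isExtendable_of_insert (D := D) (X := p.take (i + 1)) (U := p.drop (i + 1)) (w := w)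
    (by rwa [hpe]) (by rwa [hpe]) (List.ne_nil_of_length_pos (by simp; omega))
    (List.ne_nil_of_length_pos (by simp; omega))
    (by
      intro x hx
      rw [List.getLast?_take] at hx
      simp [List.getElem?_eq_getElem (show i < p.length by omega)] at hx
      exact hx ▸ h1)
    (by
      intro x hx
      rw [List.head?_drop] at hx
      simp [List.getElem?_eq_getElem hi] at hx
      exact hx ▸ h2)
  rwa [hpe] at this

/-- The new path runs `p[0..i]`, `p[j..l-1]`, `w`, `p[i+1..j-1]`, `p[l..]`; the four arcs are
exactly its new junctions. -/
lemma IsDiPath.isExtendable_of_four_adj {D : Digraph V} {p : List V} (hp : D.IsDiPath p) {w : V}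
    (hw : w ∉ p) {i j l : ℕ} (hij : i + 1 < j) (hjl : j < l) (hl : l < p.length)
    (h1 : D.Adj p[i] p[j]) (h2 : D.Adj p[l - 1] w) (h3 : D.Adj w p[i + 1])
    (h4 : D.Adj p[j - 1] p[l]) : D.IsExtendable p := by
  have hpe : p.take (i + 1) ++ ((p.take j).drop (i + 1) ++ ((p.take l).drop j ++ p.drop l)) = p := by
    have e1 : (p.take l).drop j ++ p.drop l = p.drop j := by
      conv_rhs => rw [← List.take_append_drop l p]
      rw [List.drop_append_of_le_length (by simp; omega)]
    have e2 : (p.take j).drop (i + 1) ++ p.drop j = p.drop (i + 1) := by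
      conv_rhs => rw [← List.take_append_drop j p]
      rw [List.drop_append_of_le_length (by simp; omega)]
    rw [e1, e2, List.take_append_drop]
  have hne : ∀ L : List V, 0 < L.length → L ≠ [] := fun _ => List.ne_nil_of_length_pos
  have := isExtendable_of_swap (D := D) (X := p.take (i + 1)) (Y := (p.take j).drop (i + 1))
    (Z := (p.take l).drop j) (U := p.drop l) (w := w) (by rwa [hpe]) (by rwa [hpe])
    (hne _ (by simp; omega)) (hne _ (by simp; omega)) (hne _ (by simp; omega))
    (hne _ (by simp; omega))
    (by
      intro x hx z hz
      rw [List.getLast?_take] at hx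
      rw [List.head?_drop, List.getElem?_take_of_lt hjl] at hz
      simp [List.getElem?_eq_getElem (show i < p.length by omega)] at hx
      simp [List.getElem?_eq_getElem (show j < p.length by omega)] at hz
      exact hx ▸ hz ▸ h1)
    (by
      intro z hz
      rw [List.getLast?_drop, if_neg (by simp; omega), List.getLast?_take, if_neg (by omega)] at hz
      simp [List.getElem?_eq_getElem (show l - 1 < p.length by omega)] at hz
      exact hz ▸ h2)
    (by
      intro y hy
      rw [List.head?_drop, List.getElem?_take_of_lt hij] at hy
      simp [List.getElem?_eq_getElem (show i + 1 < p.length by omega)] at hy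
      exact hy ▸ h3)
    (by
      intro y hy u hu
      rw [List.getLast?_drop, if_neg (by simp; omega), List.getLast?_take, if_neg (by omega)] at hy
      rw [List.head?_drop] at hu
      simp [List.getElem?_eq_getElem (show j - 1 < p.length by omega)] at hy
      simp [List.getElem?_eq_getElem hl] at hu
      exact hy ▸ hu ▸ h4)
  rwa [hpe] at this

/-- If `w` cannot be inserted into the path `p`, then it dominates an initial segment of `p` and
is dominated by the complementary final segment. -/
lemma IsDiPath.exists_threshold {D : Digraph V} (hD : D.IsTournament) {p : List V}
    (hp : D.IsDiPath p) (hext : ¬ D.IsExtendable p) {w : V} (hw : w ∉ p) :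
    ∃ t ≤ p.length, (∀ (i : ℕ) (hi : i < p.length), i < t → D.Adj w p[i]) ∧
      ∀ (i : ℕ) (hi : i < p.length), t ≤ i → D.Adj p[i] w := by
  classical
  have hne : ∀ (i : ℕ) (hi : i < p.length), p[i] ≠ w := by
    rintro i hi rfl
    exact hw (List.getElem_mem hi)
  -- The threshold is the first position whose vertex dominates `w`; `p.length` qualifies vacuously.
  have hex : ∃ t, ∀ ht : t < p.length, D.Adj p[t] w := ⟨p.length, fun h => absurd h (lt_irrefl _)⟩
  refine ⟨Nat.find hex, Nat.find_min' hex fun h => absurd h (lt_irrefl _), ?_, ?_⟩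
  · intro i hi hit
    have := Nat.find_min hex hit
    push Not at this
    exact (hD.not_adj_iff (hne i hi)).1 this.2
  · intro i hi hit
    induction i, hit using Nat.le_induction with
    | base => exact Nat.find_spec hex hi
    | succ i hit ih =>
      by_contra hcon
      exact hext (hp.isExtendable_of_adj_adj hw hi (ih (by omega))
        ((hD.not_adj_iff (hne _ hi)).1 hcon))

end Digraph

/-! ### Pseudo-random tournaments are path extendable -/

namespace Digraph

variable {V : Type*}

/-- Any two disjoint sets of at least `b` vertices are joined by an arc (in both directions). -/
def LargeSetsJoined (D : Digraph V) (b : ℕ) : Prop :=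
  ∀ S S' : Finset V, b ≤ S.card → b ≤ S'.card → Disjoint S S' → ∃ s ∈ S, ∃ t ∈ S', D.Adj s t

open Classical in
/-- Any two distinct vertices `u`, `v` are joined by at least `a` paths `u w v` of length two. -/
def ManyTwoPaths [Fintype V] (D : Digraph V) (a : ℕ) : Prop :=
  ∀ u v : V, u ≠ v → a ≤ (Finset.univ.filter fun w => D.Adj u w ∧ D.Adj w v).card

lemma LargeSetsJoined.exists_adj_image {D : Digraph V} {b : ℕ} (hD : D.LargeSetsJoined b)
    {f : ℕ → V} {k : ℕ} (hf : Set.InjOn f (Set.Iio k)) {I J : Finset ℕ}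
    (hI : ∀ i ∈ I, i < k) (hJ : ∀ j ∈ J, j < k) (hIb : b ≤ I.card) (hJb : b ≤ J.card)
    (hIJ : Disjoint I J) : ∃ i ∈ I, ∃ j ∈ J, D.Adj (f i) (f j) := by
  classical
  obtain ⟨s, hs, t, ht, hst⟩ := hD (I.image f) (J.image f)
    (by rwa [Finset.card_image_of_injOn (hf.mono hI)])
    (by rwa [Finset.card_image_of_injOn (hf.mono hJ)])
    (by
      rw [Finset.disjoint_left]
      intro x hx hx'
      obtain ⟨i, hi, rfl⟩ := Finset.mem_image.1 hx
      obtain ⟨j, hj, hij⟩ := Finset.mem_image.1 hx'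
      exact Finset.disjoint_left.1 hIJ hi (hf (hJ j hj) (hI i hi) hij ▸ hj))
  obtain ⟨i, hi, rfl⟩ := Finset.mem_image.1 hs
  obtain ⟨j, hj, rfl⟩ := Finset.mem_image.1 ht
  exact ⟨i, hi, j, hj, hst⟩

/-- Two crossing arcs of the kind needed to interchange segments of a path. -/
lemma LargeSetsJoined.exists_crossing {D : Digraph V} {b : ℕ} (hD : D.LargeSetsJoined b)
    {f : ℕ → V} {k t : ℕ} (hf : Set.InjOn f (Set.Iio k)) (hb : 1 ≤ b) (ht : 3 * b ≤ t)
    (hk : t + b + 1 ≤ k) :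
    ∃ i j l, i < b ∧ b + 1 ≤ j ∧ j ≤ t ∧ t + 1 ≤ l ∧ l < k ∧
      D.Adj (f i) (f j) ∧ D.Adj (f (j - 1)) (f l) := by
  classical
  -- The bad choices of `j` are those in `J₁` and the shifts by one of those in `J₂`. Each set has
  -- fewer than `b` elements, while `j` ranges over `t - b ≥ 2 * b` values.
  set J₁ := (Finset.Icc (b + 1) t).filter fun j => ∀ i < b, ¬ D.Adj (f i) (f j) with hJ₁
  set J₂ := (Finset.Icc b (t - 1)).filter fun j => ∀ l, t + 1 ≤ l → l < k → ¬ D.Adj (f j) (f l)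
    with hJ₂
  have h₁ : J₁.card < b := by
    by_contra! h
    obtain ⟨i, hi, j, hj, hij⟩ := hD.exists_adj_image hf (I := Finset.range b) (J := J₁)
      (by intro i hi; simp at hi; omega) (by intro j hj; simp [hJ₁] at hj; omega) (by simp) h
      (by
        rw [Finset.disjoint_left]
        intro i hi hi'
        simp [hJ₁] at hi hi'
        omega)
    simp only [hJ₁, Finset.mem_filter] at hj
    exact hj.2 i (by simpa using hi) hij
  have h₂ : J₂.card < b := by
    by_contra! h
    obtain ⟨i, hi, j, hj, hij⟩ := hD.exists_adj_image hf (I := J₂) (J := Finset.Ico (t + 1) k)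
      (by intro j hj; simp [hJ₂] at hj; omega) (by intro i hi; simp at hi; omega) h
      (by simp; omega)
      (by
        rw [Finset.disjoint_left]
        intro i hi hi'
        simp [hJ₂] at hi hi'
        omega)
    simp only [hJ₂, Finset.mem_filter] at hi
    simp only [Finset.mem_Ico] at hj
    exact hi.2 j hj.1 hj.2 hij
  have hcard : (J₁ ∪ J₂.image (· + 1)).card < (Finset.Icc (b + 1) t).card := by
    have := Finset.card_union_le J₁ (J₂.image (· + 1))
    have := Finset.card_image_le (s := J₂) (f := (· + 1))
    rw [Nat.card_Icc]
    omega
  obtain ⟨j, hj, hj'⟩ := Finset.exists_mem_notMem_of_card_lt_card hcard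
  rw [Finset.mem_union, not_or] at hj'
  have hjI := Finset.mem_Icc.1 hj
  have e₁ : ∃ i < b, D.Adj (f i) (f j) := by
    by_contra! h
    exact hj'.1 (Finset.mem_filter.2 ⟨hj, h⟩)
  have e₂ : ∃ l, t + 1 ≤ l ∧ l < k ∧ D.Adj (f (j - 1)) (f l) := by
    by_contra! h
    exact hj'.2 (Finset.mem_image.2 ⟨j - 1, Finset.mem_filter.2
      ⟨Finset.mem_Icc.2 ⟨by omega, by omega⟩, h⟩, by omega⟩)
  obtain ⟨i, hi, hij⟩ := e₁
  obtain ⟨l, hl, hlk, hjl⟩ := e₂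
  exact ⟨i, j, l, hi, hjI.1, hjI.2, hl, hlk, hij, hjl⟩

variable [Fintype V]

/-- A pseudo-random tournament is path extendable. -/
theorem IsTournament.isPathExtendable {D : Digraph V} (hD : D.IsTournament) {a b : ℕ}
    (hb : 1 ≤ b) (hab : 20 * b ≤ a) (hjoin : D.LargeSetsJoined b) (htwo : D.ManyTwoPaths a) :
    D.IsPathExtendable := by
  classical
  intro p hp hlen hham
  by_contra hext
  obtain ⟨w₀, hw₀⟩ : ∃ w, w ∉ p := by
    by_contra! h
    exact hham ⟨hp, h⟩
  -- The default `w₀` is a dummy: `f` is only evaluated at positions on the path.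
  set f : ℕ → V := fun i => p.getD i w₀ with hf
  have hfe : ∀ (i : ℕ) (hi : i < p.length), f i = p[i] := fun i hi =>
    List.getD_eq_getElem _ _ hi
  set k := p.length with hk
  have hfinj : Set.InjOn f (Set.Iio k) := by
    intro i hi j hj hij
    rw [hfe i hi, hfe j hj] at hij
    exact (hp.2.1.getElem_inj_iff).1 hij
  have hmem : ∀ v ∈ p, ∃ i < k, f i = v := by
    intro v hv
    obtain ⟨i, hi, rfl⟩ := List.getElem_of_mem hv
    exact ⟨i, hi, hfe i hi⟩
  have hmem' : ∀ i < k, f i ∈ p := fun i hi => by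
    rw [hfe i hi]
    exact List.getElem_mem hi
  have hcard : p.toFinset.card = k := List.toFinset_card_of_nodup hp.2.1
  -- thresholds
  have hthr : ∀ w, ∃ t, w ∉ p → t ≤ k ∧ (∀ i < t, D.Adj w (f i)) ∧
      ∀ i < k, t ≤ i → D.Adj (f i) w := by
    intro w
    by_cases hw : w ∈ p
    · exact ⟨0, fun h => absurd hw h⟩
    obtain ⟨t, ht, h1, h2⟩ := hp.exists_threshold hD hext hw
    refine ⟨t, fun _ => ⟨ht, fun i hi => ?_, fun i hi hti => ?_⟩⟩
    · rw [hfe i (by omega)]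
      exact h1 i _ hi
    · rw [hfe i hi]
      exact h2 i hi hti
  choose t ht using hthr
  -- every threshold is near one of the ends
  have hend : ∀ w, w ∉ p → t w < 3 * b ∨ k < t w + b + 1 := by
    intro w hw
    by_contra! h
    obtain ⟨i, j, l, hi, hj, hjt, hl, hlk, hij, hjl⟩ :=
      hjoin.exists_crossing hfinj hb h.1 h.2
    obtain ⟨-, h1, h2⟩ := ht w hw
    refine hext (hp.isExtendable_of_four_adj hw (i := i) (j := j) (l := l) (by omega) (by omega)
      hlk ?_ ?_ ?_ ?_)
    · rwa [hfe, hfe] at hij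
    · rw [← hfe]
      exact h2 _ (by omega) (by omega)
    · rw [← hfe]
      exact h1 _ (by omega)
    · rwa [hfe, hfe] at hjl
  -- the path is long
  have hka : a < k := by
    by_contra! hka
    have h01 : f 0 ≠ f 1 := fun h => absurd (hfinj (by simp; omega) (by simp; omega) h) (by omega)
    have hlt : (p.toFinset.erase (f 0)).card <
        (Finset.univ.filter fun w => D.Adj (f 0) w ∧ D.Adj w (f 1)).card := by
      have := htwo (f 0) (f 1) h01
      rw [Finset.card_erase_of_mem (List.mem_toFinset.2 (hmem' 0 (by omega)))]
      omega
    obtain ⟨w, hw, hw'⟩ := Finset.exists_mem_notMem_of_card_lt_card hlt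
    rw [Finset.mem_filter] at hw
    have hwp : w ∉ p := by
      intro h
      refine hw' (Finset.mem_erase.2 ⟨?_, List.mem_toFinset.2 h⟩)
      rintro rfl
      exact hD.1 _ hw.2.1
    refine hext (hp.isExtendable_of_adj_adj hwp (i := 0) (by omega) ?_ ?_)
    · rw [← hfe]
      exact hw.2.1
    · rw [← hfe]
      exact hw.2.2
  set W := p.toFinsetᶜ with hW
  have hWmem : ∀ w, w ∈ W ↔ w ∉ p := by simp [hW]
  -- few vertices are missed by the path
  have hWb : W.card < 2 * b := by
    by_contra! hWb
    have hsplit := Finset.card_filter_add_card_filter_not (s := W) (fun w => t w < 3 * b)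
    have hdisj : ∀ S ⊆ W, ∀ I : Finset ℕ, (∀ i ∈ I, i < k) → Disjoint S (I.image f) := by
      intro S hS I hI
      rw [Finset.disjoint_left]
      intro x hx hx'
      obtain ⟨i, hi, rfl⟩ := Finset.mem_image.1 hx'
      exact (hWmem _).1 (hS hx) (hmem' i (hI i hi))
    have hIcard : ∀ I : Finset ℕ, (∀ i ∈ I, i < k) → (I.image f).card = I.card := fun I hI =>
      Finset.card_image_of_injOn (hfinj.mono hI)
    rcases le_or_gt b (W.filter fun w => t w < 3 * b).card with h | h
    · have hI : ∀ i ∈ Finset.Ico (3 * b) k, i < k := by simp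
      obtain ⟨w, hw, x, hx, hwx⟩ := hjoin _ ((Finset.Ico (3 * b) k).image f) h
        (by rw [hIcard _ hI, Nat.card_Ico]; omega) (hdisj _ (Finset.filter_subset _ _) _ hI)
      obtain ⟨i, hi, rfl⟩ := Finset.mem_image.1 hx
      rw [Finset.mem_filter, hWmem] at hw
      rw [Finset.mem_Ico] at hi
      exact hD.not_adj_of_adj hwx ((ht w hw.1).2.2 i hi.2 (by omega))
    · have hI : ∀ i ∈ Finset.range (k - b), i < k := by
        intro i hi
        rw [Finset.mem_range] at hi
        omega
      obtain ⟨x, hx, w, hw, hxw⟩ := hjoin ((Finset.range (k - b)).image f)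
        (W.filter fun w => ¬ t w < 3 * b)
        (by rw [hIcard _ hI, Finset.card_range]; omega) (by omega)
        (hdisj _ (Finset.filter_subset _ _) _ hI).symm
      obtain ⟨i, hi, rfl⟩ := Finset.mem_image.1 hx
      rw [Finset.mem_filter, hWmem] at hw
      rw [Finset.mem_range] at hi
      have := (hend w hw.1).resolve_left hw.2
      exact hD.not_adj_of_adj hxw ((ht w hw.1).2.1 i (by omega))
  -- so a missed vertex has many in- and out-neighbours on the path
  obtain ⟨-, h1, h2⟩ := ht w₀ hw₀
  have hne : ∀ i < k, f i ≠ w₀ := fun i hi h => hw₀ (h ▸ hmem' i hi)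
  have hout : a ≤ (W ∪ (Finset.range (t w₀)).image f).card := by
    refine (htwo w₀ (f 0) (hne 0 (by omega)).symm).trans (Finset.card_le_card fun x hx => ?_)
    rw [Finset.mem_filter] at hx
    rw [Finset.mem_union, hWmem]
    by_cases hxp : x ∈ p
    · right
      obtain ⟨i, hi, rfl⟩ := hmem x hxp
      refine Finset.mem_image_of_mem _ (Finset.mem_range.2 ?_)
      by_contra! h
      exact hD.not_adj_of_adj hx.2.1 (h2 i hi h)
    · exact Or.inl hxp
  have hin : a ≤ (W ∪ (Finset.Ico (t w₀) k).image f).card := by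
    refine (htwo (f 0) w₀ (hne 0 (by omega))).trans (Finset.card_le_card fun x hx => ?_)
    rw [Finset.mem_filter] at hx
    rw [Finset.mem_union, hWmem]
    by_cases hxp : x ∈ p
    · right
      obtain ⟨i, hi, rfl⟩ := hmem x hxp
      refine Finset.mem_image_of_mem _ (Finset.mem_Ico.2 ⟨?_, hi⟩)
      by_contra! h
      exact hD.not_adj_of_adj hx.2.2 (h1 i h)
    · exact Or.inl hxp
  have c1 := hout.trans ((Finset.card_union_le _ _).trans
    (Nat.add_le_add_left Finset.card_image_le _))
  have c2 := hin.trans ((Finset.card_union_le _ _).trans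
    (Nat.add_le_add_left Finset.card_image_le _))
  rw [Finset.card_range] at c1
  rw [Nat.card_Ico] at c2
  -- A threshold near the start gives out-degree below `5 * b`, one near the finish in-degree below
  -- `3 * b`; both are less than `a`.
  rcases hend w₀ hw₀ with h | h <;> omega

end Digraph

/-! ### Random tournaments: union bounds by counting -/

namespace Digraph

variable {V : Type*}

/-- Reversing the arcs between `u` and `v`. -/
def flip [DecidableEq V] (D : Digraph V) (u v : V) : Digraph V where
  Adj x y := if s(x, y) = s(u, v) then D.Adj y x else D.Adj x y

section flip

variable [DecidableEq V] {D : Digraph V} {u v x y : V}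

lemma flip_adj_of_eq (h : s(x, y) = s(u, v)) : (D.flip u v).Adj x y ↔ D.Adj y x := by
  simp only [flip, if_pos h]

lemma flip_adj_of_ne (h : s(x, y) ≠ s(u, v)) : (D.flip u v).Adj x y ↔ D.Adj x y := by
  simp only [flip, if_neg h]

lemma flip_injective (u v : V) : Function.Injective fun D : Digraph V => D.flip u v := by
  intro D D' h
  ext x y
  have h' : ∀ x y, (D.flip u v).Adj x y ↔ (D'.flip u v).Adj x y := fun x y => by
    simp only at h
    rw [h]
  by_cases hxy : s(x, y) = s(u, v)
  · have := h' y x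
    rwa [flip_adj_of_eq (Sym2.eq_swap.trans hxy), flip_adj_of_eq (Sym2.eq_swap.trans hxy)] at this
  · have := h' x y
    rwa [flip_adj_of_ne hxy, flip_adj_of_ne hxy] at this

lemma IsTournament.flip (hD : D.IsTournament) (u v : V) : (D.flip u v).IsTournament := by
  refine ⟨fun x => ?_, fun x y hxy => ?_⟩
  · by_cases h : s(x, x) = s(u, v)
    · rw [flip_adj_of_eq h]
      exact hD.1 x
    · rw [flip_adj_of_ne h]
      exact hD.1 x
  · by_cases h : s(x, y) = s(u, v)
    · rw [flip_adj_of_eq h, flip_adj_of_eq (Sym2.eq_swap.trans h)]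
      exact hD.2 y x hxy.symm
    · rw [flip_adj_of_ne h, flip_adj_of_ne (fun h' => h (Sym2.eq_swap.trans h'))]
      exact hD.2 x y hxy

end flip

lemma exists_isTournament (V : Type*) : ∃ D : Digraph V, D.IsTournament := by
  let _ : LinearOrder V := WellOrderingRel.isWellOrder.linearOrder
  refine ⟨⟨fun x y => x < y⟩, fun v => lt_irrefl v, fun u v huv => ?_⟩
  rcases lt_or_gt_of_ne huv with h | h
  · exact Or.inl ⟨h, h.not_gt⟩
  · exact Or.inr ⟨h, h.not_gt⟩

/-- The probability that a uniformly random tournament on `V` has the property `P`. -/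
noncomputable def tournamentProb (P : Digraph V → Prop) : ℝ :=
  ({D | D.IsTournament ∧ P D}.ncard : ℝ) / {D : Digraph V | D.IsTournament}.ncard

section tournamentProb

instance [Finite V] : Finite (Digraph V) :=
  Finite.of_injective (fun D : Digraph V => D.Adj) fun _ _ h => Digraph.ext h

lemma tournamentProb_or_le (P Q : Digraph V → Prop) :
    tournamentProb (fun D => P D ∨ Q D) ≤ tournamentProb P + tournamentProb Q := by
  unfold tournamentProb
  rw [← add_div]
  gcongr
  have : {D : Digraph V | D.IsTournament ∧ (P D ∨ Q D)} =
      {D | D.IsTournament ∧ P D} ∪ {D | D.IsTournament ∧ Q D} := by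
    ext D
    simp only [Set.mem_ofPred_eq, Set.mem_union]
    tauto
  rw [this]
  exact_mod_cast Set.ncard_union_le _ _

variable [Finite V]

lemma ncard_isTournament_pos : 0 < {D : Digraph V | D.IsTournament}.ncard :=
  (Set.ncard_pos (Set.toFinite _)).2 (exists_isTournament V)

lemma tournamentProb_mono {P Q : Digraph V → Prop} (h : ∀ D, D.IsTournament → P D → Q D) :
    tournamentProb P ≤ tournamentProb Q := by
  have hsub : {D : Digraph V | D.IsTournament ∧ P D} ⊆ {D | D.IsTournament ∧ Q D} :=
    fun D hD => ⟨hD.1, h D hD.1 hD.2⟩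
  unfold tournamentProb
  gcongr
  exact Set.toFinite _

lemma tournamentProb_le_one (P : Digraph V → Prop) : tournamentProb P ≤ 1 := by
  have hsub : {D : Digraph V | D.IsTournament ∧ P D} ⊆ {D | D.IsTournament} := fun D hD => hD.1
  refine div_le_one_of_le₀ ?_ (Nat.cast_nonneg _)
  exact_mod_cast Set.ncard_le_ncard hsub (Set.toFinite _)

lemma one_sub_tournamentProb_not_le (P : Digraph V → Prop) :
    1 - tournamentProb (fun D => ¬ P D) ≤ tournamentProb P := by
  have h := tournamentProb_or_le P fun D => ¬ P D
  have h1 : tournamentProb (fun D : Digraph V => P D ∨ ¬ P D) = 1 := by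
    have : {D : Digraph V | D.IsTournament ∧ (P D ∨ ¬ P D)} = {D | D.IsTournament} := by
      ext D
      simp only [Set.mem_ofPred_eq]
      tauto
    rw [tournamentProb, this, div_self]
    exact_mod_cast ncard_isTournament_pos.ne'
  linarith

lemma tournamentProb_exists_le {ι : Type*} (s : Finset ι) (P : ι → Digraph V → Prop) :
    tournamentProb (fun D => ∃ i ∈ s, P i D) ≤ ∑ i ∈ s, tournamentProb (P i) := by
  classical
  induction s using Finset.induction_on with
  | empty => simp [tournamentProb]
  | insert i s hi ih =>
    rw [Finset.sum_insert hi]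
    refine le_trans (tournamentProb_mono fun D _ hD => ?_)
      ((tournamentProb_or_le _ _).trans (add_le_add_right ih _))
    simpa using hD

/-- Prescribing the directions of `m` edges has probability at most `2⁻ᵐ`. -/
lemma tournamentProb_forall_adj_le {ι : Type*} (F : Finset ι) (e : ι → V × V)
    (hinj : Set.InjOn (fun i => s((e i).1, (e i).2)) F) (hne : ∀ i ∈ F, (e i).1 ≠ (e i).2) :
    tournamentProb (fun D => ∀ i ∈ F, D.Adj (e i).1 (e i).2) ≤ (1 / 2) ^ F.card := by
  classical
  induction F using Finset.induction_on with
  | empty => simpa using tournamentProb_le_one _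
  | insert i F hi ih =>
    have ih := ih (hinj.mono (by simp)) fun j hj => hne j (Finset.mem_insert_of_mem hj)
    rw [Finset.card_insert_of_notMem hi, pow_succ]
    suffices h : 2 * tournamentProb (fun D => ∀ j ∈ insert i F, D.Adj (e j).1 (e j).2) ≤
        tournamentProb (fun D => ∀ j ∈ F, D.Adj (e j).1 (e j).2) by linarith
    set A : Set (Digraph V) := {D | D.IsTournament ∧ ∀ j ∈ insert i F, D.Adj (e j).1 (e j).2}
      with hA
    set g : Digraph V → Digraph V := fun D => D.flip (e i).1 (e i).2
    -- Reversing the new edge keeps the constraints in `F` but violates the new one, so `A` and its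
    -- equinumerous image fit disjointly in the larger event.
    have hdisj : Disjoint A (g '' A) := by
      rw [Set.disjoint_left]
      rintro _ hD ⟨D', hD', rfl⟩
      have h1 := hD.2 i (Finset.mem_insert_self _ _)
      rw [flip_adj_of_eq rfl] at h1
      exact hD'.1.not_adj_of_adj h1 (hD'.2 i (Finset.mem_insert_self _ _))
    have hsub : A ∪ g '' A ⊆ {D | D.IsTournament ∧ ∀ j ∈ F, D.Adj (e j).1 (e j).2} := by
      rintro D (hD | ⟨D, hD, rfl⟩)
      · exact ⟨hD.1, fun j hj => hD.2 j (Finset.mem_insert_of_mem hj)⟩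
      · refine ⟨hD.1.flip _ _, fun j hj => ?_⟩
        rw [flip_adj_of_ne]
        · exact hD.2 j (Finset.mem_insert_of_mem hj)
        · intro h
          have := hinj (Finset.mem_coe.2 (Finset.mem_insert_of_mem hj))
            (Finset.mem_coe.2 (Finset.mem_insert_self i F)) h
          exact hi (this ▸ hj)
    have hcard := Set.ncard_le_ncard hsub (Set.toFinite _)
    rw [Set.ncard_union_eq hdisj (Set.toFinite _) (Set.toFinite _),
      Set.ncard_image_of_injective _ (flip_injective _ _), ← two_mul] at hcard
    unfold tournamentProb
    rw [← mul_div_assoc]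
    gcongr
    exact_mod_cast hcard

end tournamentProb

variable [Fintype V]

/-- Failure for a pair `S`, `S'` forces every arc from `S'` to `S`, hence at least `b ^ 2` edges;
there are at most `4 ^ n` pairs of sets. -/
lemma tournamentProb_not_largeSetsJoined_le (b : ℕ) :
    tournamentProb (fun D : Digraph V => ¬ D.LargeSetsJoined b) ≤
      4 ^ Fintype.card V * (1 / 2) ^ (b ^ 2) := by
  classical
  set I : Finset (Finset V × Finset V) :=
    Finset.univ.filter fun q => b ≤ q.1.card ∧ b ≤ q.2.card ∧ Disjoint q.1 q.2 with hI
  calc tournamentProb (fun D : Digraph V => ¬ D.LargeSetsJoined b)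
      ≤ tournamentProb (fun D : Digraph V =>
          ∃ q ∈ I, ∀ e ∈ q.2 ×ˢ q.1, D.Adj (id e).1 (id e).2) := by
        refine tournamentProb_mono fun D hD h => ?_
        unfold LargeSetsJoined at h
        push Not at h
        obtain ⟨S, S', hS, hS', hdisj, h⟩ := h
        refine ⟨(S, S'), by simp [hI, hS, hS', hdisj], fun e he => ?_⟩
        rw [Finset.mem_product] at he
        have hne : e.2 ≠ e.1 := by
          intro hh
          rw [hh] at he
          exact Finset.disjoint_left.1 hdisj he.2 he.1
        exact (hD.not_adj_iff hne).1 (h _ he.2 _ he.1)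
    _ ≤ ∑ q ∈ I, tournamentProb (fun D : Digraph V =>
          ∀ e ∈ q.2 ×ˢ q.1, D.Adj (id e).1 (id e).2) := tournamentProb_exists_le _ _
    _ ≤ ∑ q ∈ I, (1 / 2 : ℝ) ^ (b ^ 2) := by
        refine Finset.sum_le_sum fun q hq => ?_
        simp only [hI, Finset.mem_filter, Finset.mem_univ, true_and] at hq
        obtain ⟨h1, h2, hdisj⟩ := hq
        rw [Finset.disjoint_left] at hdisj
        refine (tournamentProb_forall_adj_le (q.2 ×ˢ q.1) id ?_ ?_).trans ?_
        · rintro ⟨x, y⟩ hxy ⟨x', y'⟩ hxy' h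
          simp only [Finset.coe_product, Set.mem_prod, Finset.mem_coe, id, Sym2.eq_iff] at hxy hxy' h
          rcases h with ⟨rfl, rfl⟩ | ⟨rfl, rfl⟩
          · rfl
          · exact absurd hxy.1 (hdisj hxy'.2)
        · rintro ⟨x, y⟩ hxy h
          simp only [Finset.mem_product, id] at hxy h
          exact hdisj hxy.2 (h ▸ hxy.1)
        · refine pow_le_pow_of_le_one (by norm_num) (by norm_num) ?_
          rw [Finset.card_product, sq]
          exact Nat.mul_le_mul h2 h1
    _ ≤ 4 ^ Fintype.card V * (1 / 2) ^ (b ^ 2) := by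
        rw [Finset.sum_const, nsmul_eq_mul]
        gcongr
        have : I.card ≤ 4 ^ Fintype.card V := by
          refine (Finset.card_le_univ I).trans_eq ?_
          rw [Fintype.card_prod, Fintype.card_finset, ← mul_pow]
          norm_num
        exact_mod_cast this

-- A union bound over the patterns of arcs between `{u, v}` and the other vertices, each of
-- probability at most `(1 / 4) ^ |R|`. The weight `2 ^ (a - good f)` exceeds `1` on bad patterns,
-- and summing it over all patterns factorises over `R`.
open Classical in
lemma tournamentProb_few_twoPaths_le {u v : V} (huv : u ≠ v) (a : ℕ) :
    tournamentProb (fun D : Digraph V =>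
      (Finset.univ.filter fun w => D.Adj u w ∧ D.Adj w v).card < a) ≤
      2 ^ a * (7 / 8) ^ (Fintype.card V - 2) := by
  let R := {w : V // w ≠ u ∧ w ≠ v}
  have hR : Fintype.card R = Fintype.card V - 2 := by
    rw [Fintype.card_subtype, ← Finset.card_pair huv, ← Finset.card_compl]
    congr 1
    ext w
    simp
  let arc : (R → Bool × Bool) → R × Bool → V × V := fun f i =>
    bif i.2 then (bif (f i.1).1 then (u, i.1.1) else (i.1.1, u))
    else (bif (f i.1).2 then (i.1.1, v) else (v, i.1.1))
  have harc : ∀ f i, s((arc f i).1, (arc f i).2) = bif i.2 then s(u, i.1.1) else s(v, i.1.1) := by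
    rintro f ⟨w, c⟩
    simp only [arc]
    cases c <;> cases (f w).1 <;> cases (f w).2 <;> simp [Sym2.eq_swap]
  let good : (R → Bool × Bool) → ℕ := fun f => (Finset.univ.filter fun w => f w = (true, true)).card
  set I : Finset (R → Bool × Bool) := Finset.univ.filter fun f => good f < a with hI
  calc tournamentProb (fun D : Digraph V =>
        (Finset.univ.filter fun w => D.Adj u w ∧ D.Adj w v).card < a)
      ≤ tournamentProb (fun D : Digraph V =>
          ∃ f ∈ I, ∀ i ∈ Finset.univ, D.Adj (arc f i).1 (arc f i).2) := by
        refine tournamentProb_mono fun D hD h => ?_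
        refine ⟨fun w => (decide (D.Adj u w), decide (D.Adj w v)), ?_, ?_⟩
        · simp only [hI, Finset.mem_filter, Finset.mem_univ, true_and]
          refine lt_of_le_of_lt ?_ h
          refine Finset.card_le_card_of_injOn Subtype.val ?_ Subtype.val_injective.injOn
          intro w hw
          simpa using hw
        · rintro ⟨w, c⟩ -
          simp only [arc]
          cases c
          · by_cases hw : D.Adj w v
            · simp [hw]
            · simpa [hw] using (hD.not_adj_iff w.2.2).1 hw
          · by_cases hw : D.Adj u w
            · simp [hw]
            · simpa [hw] using (hD.not_adj_iff w.2.1.symm).1 hw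
    _ ≤ ∑ f ∈ I, tournamentProb (fun D : Digraph V =>
          ∀ i ∈ Finset.univ, D.Adj (arc f i).1 (arc f i).2) := tournamentProb_exists_le _ _
    _ ≤ ∑ f ∈ I, (1 / 4 : ℝ) ^ Fintype.card R := by
        refine Finset.sum_le_sum fun f _ => ?_
        refine (tournamentProb_forall_adj_le Finset.univ (arc f) ?_ ?_).trans_eq ?_
        · rintro ⟨⟨w, hw⟩, c⟩ - ⟨⟨w', hw'⟩, c'⟩ - h
          simp only [harc] at h
          cases c <;> cases c' <;> simp at h ⊢ <;> grind
        · rintro ⟨⟨w, hw⟩, c⟩ -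
          have h := harc f (⟨w, hw⟩, c)
          intro h'
          rw [h'] at h
          cases c <;> simp at h <;> grind
        · rw [Finset.card_univ, Fintype.card_prod, Fintype.card_bool, mul_comm, pow_mul]
          norm_num
    _ ≤ ∑ f ∈ I, 2 ^ a * (1 / 4 : ℝ) ^ Fintype.card R * (1 / 2) ^ good f := by
        refine Finset.sum_le_sum fun f hf => ?_
        simp only [hI, Finset.mem_filter, Finset.mem_univ, true_and] at hf
        have h1 : (1 : ℝ) ≤ 2 ^ a * (1 / 2) ^ good f := by
          rw [one_div, inv_pow, ← div_eq_mul_inv, one_le_div (by positivity)]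
          exact pow_le_pow_right₀ (by norm_num) hf.le
        have h2 : (0 : ℝ) < (1 / 4) ^ Fintype.card R := by positivity
        nlinarith
    _ ≤ ∑ f : R → Bool × Bool, 2 ^ a * (1 / 4 : ℝ) ^ Fintype.card R * (1 / 2) ^ good f :=
        Finset.sum_le_sum_of_subset_of_nonneg (Finset.filter_subset _ _)
          fun _ _ _ => by positivity
    _ = 2 ^ a * (7 / 8) ^ (Fintype.card V - 2) := by
        -- Each vertex contributes `1 + 1 + 1 + 1 / 2 = 7 / 2`; multiplying by `1 / 4` gives `7 /
        -- 8`.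
        have hsum : ∑ f : R → Bool × Bool, (1 / 2 : ℝ) ^ good f = (7 / 2) ^ Fintype.card R := by
          have h1 : ∀ f : R → Bool × Bool, (1 / 2 : ℝ) ^ good f =
              ∏ w, if f w = (true, true) then (1 / 2 : ℝ) else 1 := by
            intro f
            rw [Finset.prod_ite, Finset.prod_const, Finset.prod_const_one, mul_one]
          simp only [h1]
          rw [← Fintype.piFinset_univ, ← Finset.prod_univ_sum (fun _ : R => Finset.univ)
            (fun _ c => if c = (true, true) then (1 / 2 : ℝ) else 1), Finset.prod_const,
            Finset.card_univ]
          congr 1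
          simp [Fintype.sum_prod_type]
          norm_num
        rw [← Finset.mul_sum, hsum, mul_assoc, ← mul_pow, hR]
        norm_num

lemma tournamentProb_not_manyTwoPaths_le (a : ℕ) :
    tournamentProb (fun D : Digraph V => ¬ D.ManyTwoPaths a) ≤
      (Fintype.card V : ℝ) ^ 2 * (2 ^ a * (7 / 8) ^ (Fintype.card V - 2)) := by
  classical
  set I : Finset (V × V) := Finset.univ.filter fun q => q.1 ≠ q.2 with hI
  calc tournamentProb (fun D : Digraph V => ¬ D.ManyTwoPaths a)
      ≤ tournamentProb (fun D : Digraph V => ∃ q ∈ I,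
          (Finset.univ.filter fun w => D.Adj q.1 w ∧ D.Adj w q.2).card < a) := by
        refine tournamentProb_mono fun D _ h => ?_
        unfold ManyTwoPaths at h
        push Not at h
        obtain ⟨u, v, huv, h⟩ := h
        exact ⟨(u, v), by simpa [hI] using huv, by convert h⟩
    _ ≤ ∑ q ∈ I, 2 ^ a * (7 / 8 : ℝ) ^ (Fintype.card V - 2) := by
        refine (tournamentProb_exists_le _ _).trans (Finset.sum_le_sum fun q hq => ?_)
        convert tournamentProb_few_twoPaths_le (Finset.mem_filter.1 hq).2 a
    _ ≤ _ := by
        rw [Finset.sum_const, nsmul_eq_mul]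
        gcongr
        have : I.card ≤ Fintype.card V ^ 2 := by
          refine (Finset.card_le_univ I).trans_eq ?_
          rw [Fintype.card_prod, sq]
        exact_mod_cast this

end Digraph

/-! ### Choice of parameters and the limit -/

namespace Digraph

lemma one_sub_le_tournamentProb_isPathExtendable {V : Type*} [Fintype V] {a b : ℕ} (hb : 1 ≤ b)
    (hab : 20 * b ≤ a) :
    1 - (4 ^ Fintype.card V * (1 / 2) ^ (b ^ 2) +
      (Fintype.card V : ℝ) ^ 2 * (2 ^ a * (7 / 8) ^ (Fintype.card V - 2))) ≤
      tournamentProb fun D : Digraph V => D.IsPathExtendable := by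
  refine le_trans ?_ (one_sub_tournamentProb_not_le _)
  refine sub_le_sub_left ?_ _
  refine le_trans ?_ (add_le_add (tournamentProb_not_largeSetsJoined_le b)
    (tournamentProb_not_manyTwoPaths_le a))
  refine le_trans (tournamentProb_mono fun D hD h => ?_) (tournamentProb_or_le _ _)
  by_contra! h'
  exact h (hD.isPathExtendable hb hab h'.1 h'.2)

end Digraph

lemma tendsto_four_pow_mul_half_pow_sq :
    Tendsto (fun q : ℕ => (4 : ℝ) ^ (200 * (q + 1)) * (1 / 2) ^ (q ^ 2)) atTop (𝓝 0) := by
  refine squeeze_zero' (Eventually.of_forall fun q => by positivity) ?_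
    (tendsto_pow_atTop_nhds_zero_of_lt_one (r := (1 / 2 : ℝ)) (by norm_num) (by norm_num))
  filter_upwards [eventually_ge_atTop 402] with q hq
  have h : 400 * (q + 1) + q ≤ q ^ 2 := by nlinarith
  calc (4 : ℝ) ^ (200 * (q + 1)) * (1 / 2) ^ (q ^ 2)
      ≤ 4 ^ (200 * (q + 1)) * (1 / 2) ^ (400 * (q + 1) + q) := by
        gcongr ?_ * ?_
        exact pow_le_pow_of_le_one (by norm_num) (by norm_num) h
    _ = (1 / 2) ^ q := by
        rw [pow_add, ← mul_assoc, show 400 * (q + 1) = 2 * (200 * (q + 1)) by ring, pow_mul (1 / 2 : ℝ) 2,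
          ← mul_pow]
        norm_num

lemma tendsto_sq_mul_two_pow_mul_pow :
    Tendsto (fun q : ℕ => ((200 * (q + 1) : ℕ) : ℝ) ^ 2 * (2 ^ (20 * q) * (7 / 8) ^ (200 * q - 2)))
      atTop (𝓝 0) := by
  have h0 := (tendsto_pow_const_mul_const_pow_of_abs_lt_one 2
    (r := (1 / 2 : ℝ)) (by rw [abs_of_pos] <;> norm_num)).const_mul (160000 * (64 / 49))
  rw [mul_zero] at h0
  refine squeeze_zero' (Eventually.of_forall fun q => by positivity) ?_ h0
  filter_upwards [eventually_ge_atTop 1] with q hq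
  have hq' : (1 : ℝ) ≤ q := by exact_mod_cast hq
  have h1 : ((200 * (q + 1) : ℕ) : ℝ) ^ 2 ≤ 160000 * (q : ℝ) ^ 2 := by
    push_cast
    nlinarith
  have h2 : (2 : ℝ) ^ (20 * q) * (7 / 8) ^ (200 * q - 2) ≤ 64 / 49 * (1 / 2) ^ q := by
    have h3 : (7 / 8 : ℝ) ^ (200 * q - 2) = 64 / 49 * (7 / 8) ^ (200 * q) := by
      obtain ⟨m, hm⟩ : ∃ m, 200 * q = m + 2 := ⟨200 * q - 2, by omega⟩
      rw [hm, Nat.add_sub_cancel, pow_add]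
      norm_num
      ring
    -- The ratio `200 : 20` is large enough: `2 ^ 20 * (7 / 8) ^ 200 ≤ 1 / 2`.
    have h4 : (2 : ℝ) ^ (20 * q) * (7 / 8) ^ (200 * q) ≤ (1 / 2) ^ q := by
      rw [pow_mul, pow_mul, ← mul_pow]
      refine pow_le_pow_left₀ (by positivity) ?_ q
      norm_num
    rw [h3]
    linarith
  calc _ ≤ 160000 * (q : ℝ) ^ 2 * (64 / 49 * (1 / 2) ^ q) := by gcongr
    _ = _ := by ring

theorem theorem2p8 : Tendsto pathExtendableProportion atTop (𝓝 1) := by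
  have hprop : ∀ n, pathExtendableProportion n =
      Digraph.tournamentProb fun D : Digraph (Fin n) => D.IsPathExtendable := fun n => rfl
  have hdiv : Tendsto (fun n : ℕ => n / 200) atTop atTop :=
    Nat.tendsto_div_const_atTop (by norm_num)
  have herr := (tendsto_four_pow_mul_half_pow_sq.add tendsto_sq_mul_two_pow_mul_pow).comp hdiv
  have hlow := herr.const_sub 1
  rw [add_zero, sub_zero] at hlow
  refine tendsto_of_tendsto_of_tendsto_of_le_of_le' hlow tendsto_const_nhds ?_
    (Eventually.of_forall fun n => (hprop n).trans_le (Digraph.tournamentProb_le_one _))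
  filter_upwards [eventually_ge_atTop 200] with n hn
  rw [hprop]
  -- With `q = n / 200`, take `b = q` and, through `le_rfl`, `a = 20 * q`. Rounding costs only `200
  -- * q ≤ n ≤ 200 * (q + 1)`.
  refine le_trans (sub_le_sub_left ?_ _)
    (Digraph.one_sub_le_tournamentProb_isPathExtendable (b := n / 200) (by omega) le_rfl)
  rw [Fintype.card_fin]
  simp only [Function.comp_apply]
  refine add_le_add ?_ ?_
  · gcongr ?_ * _
    exact pow_le_pow_right₀ (by norm_num) (by omega)
  · gcongr ?_ ^ 2 * (_ * ?_)
    · exact_mod_cast (show n ≤ 200 * (n / 200 + 1) by omega)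
    · exact pow_le_pow_of_le_one (by norm_num) (by norm_num) (by omega)
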